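/- Let $X$ be a continuum, that is, a nonempty compact connected Hausdorff space, in which every point has a neighborhood homeomorphic to $C\times I$, where $C$ is the usual Cantor set and $I$ is an open interval. (Such a space is automatically metrizable.) If $h\colon C\times I\to U$ is a homeomorphism onto a neighborhood $U$ of a point $p=h(c,a)$, the set $h(\{c\}\times I)$ is called the local leaf of $p$ relative to $U$ and $h$. A segment is a union $\ell_1\cup\dots\cup\ell_n$ ($n\ge 1$) of local leaves with $\ell_i\cap\ell_{i+1}\neq\emptyset$ for $1\le i<n$, and the leaf at a point $x\in X$ is the union of all segments containing $x$. If some leaf is dense in $X$, then $X$ is indecomposable, that is, $X$ is not the union of two proper subcontinua (compact connected proper subsets). -/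

import Mathlib

open Set Topology

/-- The model space: the usual Cantor set times an open interval. -/
abbrev CantorBox : Type := cantorSet × Ioo (0 : ℝ) 1

/-- A homeomorphism `e` of `C × I` onto a neighborhood of `x`. -/
def IsBoxChartAt {X : Type*} [TopologicalSpace X] (e : CantorBox → X) (x : X) : Prop :=
  IsEmbedding e ∧ range e ∈ 𝓝 x

/-- Every point has a neighborhood homeomorphic to (Cantor set) × (open interval). -/
def LocallyCantorTimesInterval (X : Type*) [TopologicalSpace X] : Prop :=
  ∀ x : X, ∃ e : CantorBox → X, IsBoxChartAt e x

/-- `l` is the local leaf `{c} × I` of some point `(c, a)`, relative to a neighborhood `C × I`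
of that point. -/
def IsLocalLeaf {X : Type*} [TopologicalSpace X] (l : Set X) : Prop :=
  ∃ (e : CantorBox → X) (c : cantorSet) (a : Ioo (0 : ℝ) 1),
    IsBoxChartAt e (e (c, a)) ∧ l = e '' ({c} ×ˢ univ)

/-- A segment: the union of a finite nonempty chain of local leaves, each of which meets
the next one. -/
def IsSegment {X : Type*} [TopologicalSpace X] (S : Set X) : Prop :=
  ∃ L : List (Set X), L ≠ [] ∧ (∀ l ∈ L, IsLocalLeaf l) ∧
    L.IsChain (fun l m => (l ∩ m).Nonempty) ∧ S = ⋃ l ∈ L, l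

/-- The leaf at `x`: the union of the segments containing `x`. -/
def leafAt {X : Type*} [TopologicalSpace X] (x : X) : Set X :=
  ⋃₀ {S : Set X | IsSegment S ∧ x ∈ S}

/-- A subcontinuum of a space: a compact connected (nonempty) subset. -/
def IsSubcontinuum {X : Type*} [TopologicalSpace X] (K : Set X) : Prop :=
  IsCompact K ∧ IsConnected K

/-- A space is decomposable if it is the union of two proper subcontinua. -/
def IsDecomposable (X : Type*) [TopologicalSpace X] : Prop :=
  ∃ A B : Set X, IsSubcontinuum A ∧ IsSubcontinuum B ∧ A ≠ univ ∧ B ≠ univ ∧ A ∪ B = univ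

/-- A space is indecomposable if it is not decomposable. -/
def IsIndecomposable (X : Type*) [TopologicalSpace X] : Prop :=
  ¬ IsDecomposable X

/-! Suppose `X = A ∪ B` with `A`, `B` closed, connected and proper. A dense leaf lies in a dense
path component, and only the latter is used: it contains a point outside `A` and a point outside
`B`. The arc in the leaf between them is carried by a tube, a map `φ : C × ℝ → X` that is a local
homeomorphism along `{d} × [v, w]`. The strand `φ (d, ·)` may wrap around or cross itself;
injectivity is never needed.

Two facts give the contradiction. First (`IsTube.mem_of_mem_interior`), a strand cannot leave a
closed connected set at both ends while meeting its interior in between: a thin clopen family of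
strands around it would cut a relatively clopen piece off the set. Secondly
(`IsTube.mem_or_mem_of_dense`), density brings the path component back to a parallel strand disjoint
from the first, which also has one end outside `A` and the other outside `B`. The original tube is
prolonged until it reaches this parallel strand, beyond `v` or beyond `w`, and then along it to the
end that suits. Three points on one strand result, the outer two outside `B` and the middle one
outside `A`, hence interior to `B`, or the same with `A` and `B` exchanged. The first fact excludes
both.

Prolonging tubes along paths (`HasBoxCharts.liftsTo_image`) rests on total disconnectedness of `C`:
a path inside a box stays in one plaque `{c} × I`, and a change of boxes induces a local
homeomorphism of `C`. -/

open Filter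

/-! ### Local homeomorphisms at a point. -/

section LocalHomeomorphisms

variable {Y Z W : Type*} [TopologicalSpace Y] [TopologicalSpace Z] [TopologicalSpace W]

/-- `f` is a homeomorphism from some open neighborhood of `y` onto an open set. -/
def LocHomeoAt (f : Y → Z) (y : Y) : Prop :=
  ∃ e : OpenPartialHomeomorph Y Z, y ∈ e.source ∧ EqOn f e e.source

theorem OpenPartialHomeomorph.locHomeoAt (e : OpenPartialHomeomorph Y Z) {y : Y}
    (hy : y ∈ e.source) : LocHomeoAt e y :=
  ⟨e, hy, fun _ _ => rfl⟩

theorem LocHomeoAt.eventually {f : Y → Z} {y : Y} (h : LocHomeoAt f y) :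
    ∀ᶠ x in 𝓝 y, LocHomeoAt f x := by
  obtain ⟨e, hy, he⟩ := h
  filter_upwards [e.open_source.mem_nhds hy] with x hx using ⟨e, hx, he⟩

theorem LocHomeoAt.map_nhds {f : Y → Z} {y : Y} (h : LocHomeoAt f y) :
    map f (𝓝 y) = 𝓝 (f y) := by
  obtain ⟨e, hy, he⟩ := h
  have : f =ᶠ[𝓝 y] e := by
    filter_upwards [e.open_source.mem_nhds hy] with x hx using he hx
  rw [map_congr this, he hy, e.map_nhds_eq hy]

theorem LocHomeoAt.continuousAt {f : Y → Z} {y : Y} (h : LocHomeoAt f y) : ContinuousAt f y :=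
  h.map_nhds.le

theorem LocHomeoAt.comp {g : Z → W} {f : Y → Z} {y : Y} (hg : LocHomeoAt g (f y))
    (hf : LocHomeoAt f y) : LocHomeoAt (g ∘ f) y := by
  obtain ⟨e, hy, he⟩ := hf
  obtain ⟨e', hy', he'⟩ := hg
  refine ⟨e.trans e', ?_, ?_⟩
  · rw [OpenPartialHomeomorph.trans_source]
    exact ⟨hy, by rw [mem_preimage, ← he hy]; exact hy'⟩
  · intro x hx
    rw [OpenPartialHomeomorph.trans_source] at hx
    have h2 : e x ∈ e'.source := hx.2
    simp [he hx.1, he' h2]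

theorem LocHomeoAt.congr {f g : Y → Z} {y : Y} (hf : LocHomeoAt f y) (hfg : g =ᶠ[𝓝 y] f) :
    LocHomeoAt g y := by
  obtain ⟨e, hy, he⟩ := hf
  obtain ⟨U, hU, hUo, hyU⟩ := mem_nhds_iff.1 hfg
  refine ⟨e.restrOpen U hUo, ?_, ?_⟩
  · rw [OpenPartialHomeomorph.restrOpen_source]; exact ⟨hy, hyU⟩
  · intro x hx
    rw [OpenPartialHomeomorph.restrOpen_source] at hx
    exact (hU hx.2).trans (he hx.1)

theorem isOpen_image_of_locHomeoAt {f : Y → Z} {U : Set Y} (hU : IsOpen U)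
    (h : ∀ y ∈ U, LocHomeoAt f y) : IsOpen (f '' U) := by
  rw [isOpen_iff_mem_nhds]
  rintro _ ⟨y, hy, rfl⟩
  rw [← (h y hy).map_nhds]
  exact image_mem_map (hU.mem_nhds hy)

theorem locHomeoAt_of_injOn {f : Y → Z} {U : Set Y} {y : Y} (hU : IsOpen U) (hy : y ∈ U)
    (hc : ContinuousOn f U) (hi : InjOn f U) (ho : ∀ x ∈ U, 𝓝 (f x) ≤ map f (𝓝 x)) :
    LocHomeoAt f y := by
  have : Nonempty Y := ⟨y⟩
  have hopen : IsOpenMap (U.domRestrict f) := by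
    rw [isOpenMap_iff_nhds_le]
    rintro ⟨x, hx⟩
    have : map (U.domRestrict f) (𝓝 ⟨x, hx⟩) = map f (𝓝 x) := by
      rw [← map_nhds_subtype_coe_eq_nhds hx (hU.mem_nhds hx), Filter.map_map]; rfl
    rw [this]
    exact ho x hx
  exact ⟨OpenPartialHomeomorph.ofContinuousOpenRestrict (hi.toPartialEquiv f U) hc hopen hU,
    hy, fun _ _ => rfl⟩

theorem locHomeoAt_of_local_inverse {f : Y → Z} {g : Z → Y} {y : Y}
    (hgf : ∀ᶠ x in 𝓝 y, g (f x) = x) (hfg : ∀ᶠ z in 𝓝 (f y), f (g z) = z)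
    (hf : ∀ᶠ x in 𝓝 y, ContinuousAt f x) (hg : ∀ᶠ z in 𝓝 (f y), ContinuousAt g z) :
    LocHomeoAt f y := by
  have h1 := hf.self_of_nhds.tendsto.eventually (hfg.eventually_nhds.and hg)
  obtain ⟨U, hU, hUo, hyU⟩ := mem_nhds_iff.1 ((hgf.and hf).and h1)
  refine locHomeoAt_of_injOn hUo hyU (fun x hx => (hU hx).1.2.continuousWithinAt) ?_ ?_
  · intro x hx x' hx' h
    rw [← (hU hx).1.1, ← (hU hx').1.1, h]
  · intro x hx
    obtain ⟨⟨h2, h3⟩, h4, h5⟩ := hU hx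
    have h6 : Tendsto g (𝓝 (f x)) (𝓝 x) := by
      have := h5.tendsto
      rwa [h2] at this
    calc 𝓝 (f x) = map (f ∘ g) (𝓝 (f x)) := by
          conv_lhs => rw [← Filter.map_id (f := 𝓝 (f x))]
          exact (map_congr (by filter_upwards [h4] with z hz using hz)).symm
      _ = map f (map g (𝓝 (f x))) := (Filter.map_map).symm
      _ ≤ map f (𝓝 x) := map_mono h6

end LocalHomeomorphisms

/-! ### Locally injective real functions. -/

section RealFunctions

theorem not_isLocalExtr_of_strictMonoOn {f : ℝ → ℝ} {c : ℝ} {N : Set ℝ} (hN : N ∈ 𝓝 c)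
    (hf : StrictMonoOn f N) : ¬ IsLocalExtr f c := by
  have hc := mem_of_mem_nhds hN
  rintro (h | h)
  · obtain ⟨x, ⟨hx1, hx2⟩, hx3⟩ := (((h.and hN).filter_mono nhdsWithin_le_nhds).and
      (self_mem_nhdsWithin (s := Iio c))).exists
    exact absurd (hf hx2 hc hx3) (not_lt.2 hx1)
  · obtain ⟨x, ⟨hx1, hx2⟩, hx3⟩ := (((h.and hN).filter_mono nhdsWithin_le_nhds).and
      (self_mem_nhdsWithin (s := Ioi c))).exists
    exact absurd (hf hc hx2 hx3) (not_lt.2 hx1)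

/-- Two equal values would force an interior local extremum, as in Rolle's theorem; but near any
interior point `f` is continuous and injective, hence strictly monotone. -/
theorem strictMonoOn_or_strictAntiOn_of_locally_injOn {f : ℝ → ℝ} {a b : ℝ} (hab : a ≤ b)
    (hc : ContinuousOn f (Icc a b)) (hi : ∀ t ∈ Ioo a b, ∃ N ∈ 𝓝 t, InjOn f N) :
    StrictMonoOn f (Icc a b) ∨ StrictAntiOn f (Icc a b) := by
  refine hc.strictMonoOn_of_injOn_Icc' hab ?_
  have key : ∀ x ∈ Icc a b, ∀ y ∈ Icc a b, x < y → f x ≠ f y := by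
    intro x hx y hy hxy hfxy
    have hsub : Icc x y ⊆ Icc a b := Icc_subset_Icc hx.1 hy.2
    obtain ⟨c, hcm, hext⟩ := exists_isLocalExtr_Ioo hxy (hc.mono hsub) hfxy
    have hcab : c ∈ Ioo a b := ⟨hx.1.trans_lt hcm.1, hcm.2.trans_le hy.2⟩
    obtain ⟨N, hN, hinj⟩ := hi c hcab
    obtain ⟨ε, hε, hball⟩ := Metric.nhds_basis_closedBall.mem_iff.1
      (inter_mem hN (Ioo_mem_nhds hcab.1 hcab.2))
    rw [Real.closedBall_eq_Icc] at hball
    have hnh : Icc (c - ε) (c + ε) ∈ 𝓝 c := Icc_mem_nhds (by linarith) (by linarith)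
    rcases ContinuousOn.strictMonoOn_of_injOn_Icc' (f := f) (by linarith : c - ε ≤ c + ε)
      (hc.mono fun t ht => Ioo_subset_Icc_self (hball ht).2)
      (hinj.mono fun t ht => (hball ht).1) with h | h
    · exact not_isLocalExtr_of_strictMonoOn hnh h hext
    · exact not_isLocalExtr_of_strictMonoOn hnh (f := fun t => - f t)
        (fun s hs t ht hst => neg_lt_neg (h hs ht hst)) hext.neg
  intro x hx y hy hxy
  rcases lt_trichotomy x y with h | h | h
  · exact absurd hxy (key x hx y hy h)
  · exact h
  · exact absurd hxy.symm (key y hy x hx h)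

end RealFunctions

/-! ### Local homeomorphisms of `C × ℝ` and holonomy. -/

section ProductStructure

variable {C C' : Type*} [TopologicalSpace C] [TopologicalSpace C']

theorem ContinuousAt.slice_fst {Y : Type*} [TopologicalSpace Y] {f : C × ℝ → Y} {x : C} {s : ℝ}
    (hf : ContinuousAt f (x, s)) : ContinuousAt (fun y => f (y, s)) x :=
  ContinuousAt.comp (f := fun y => (y, s)) hf (by fun_prop)

theorem eqOn_of_isPreconnected [TotallyDisconnectedSpace C] {Y : Type*} [TopologicalSpace Y]
    {g : Y → C} {I : Set Y} (hI : IsPreconnected I) (hg : ContinuousOn g I) {s t : Y}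
    (hs : s ∈ I) (ht : t ∈ I) : g s = g t :=
  (hI.image g hg).subsingleton (mem_image_of_mem g hs) (mem_image_of_mem g ht)

theorem exists_box_subset {d : C} {t : ℝ} {S : Set (C × ℝ)} (hS : S ∈ 𝓝 (d, t)) :
    ∃ D : Set C, IsOpen D ∧ d ∈ D ∧ ∃ ε > 0, D ×ˢ Ioo (t - ε) (t + ε) ⊆ S := by
  rw [nhds_prod_eq] at hS
  obtain ⟨⟨D, ε⟩, ⟨⟨hdD, hDo⟩, hε⟩, h⟩ :=
    ((nhds_basis_opens d).prod (Metric.nhds_basis_ball (x := t))).mem_iff.1 hS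
  exact ⟨D, hDo, hdD, ε, hε, by rwa [Real.ball_eq_Ioo] at h⟩

/-- The map is triangular, so injectivity is immediate. Openness comes from the intermediate value
theorem: the values of `κ` at two heights bracketing `t` still bracket a fixed interval when the
point of `C` moves slightly. -/
theorem LocHomeoAt.prodMk_strictMonoOn {h : C → C'} {κ : C × ℝ → ℝ} {d : C}
    (hh : LocHomeoAt h d) {N : Set C} (hN : N ∈ 𝓝 d) {a b t₀ : ℝ} (ht₀ : t₀ ∈ Ioo a b)
    (hκ : ContinuousOn κ (N ×ˢ Ioo a b))
    (hmono : ∀ d' ∈ N, StrictMonoOn (fun t => κ (d', t)) (Ioo a b)) :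
    LocHomeoAt (fun p : C × ℝ => (h p.1, κ p)) (d, t₀) := by
  obtain ⟨e, hd, he⟩ := hh
  set D := e.source ∩ interior N with hD
  have hDo : IsOpen D := e.open_source.inter isOpen_interior
  have hDN : D ⊆ N := fun x hx => interior_subset hx.2
  have hcD : ∀ x ∈ D, LocHomeoAt h x := fun x hx => ⟨e, hx.1, he⟩
  refine locHomeoAt_of_injOn (U := D ×ˢ Ioo a b) (hDo.prod isOpen_Ioo)
    ⟨⟨hd, mem_interior_iff_mem_nhds.2 hN⟩, ht₀⟩ ?_ ?_ ?_
  · refine ContinuousOn.prodMk ?_ (hκ.mono (prod_mono_left hDN))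
    exact fun p hp => ((hcD p.1 hp.1).continuousAt.comp continuousAt_fst).continuousWithinAt
  · rintro ⟨x, s⟩ ⟨hx, hs⟩ ⟨y, t⟩ ⟨hy, ht⟩ hxy
    simp only [Prod.mk.injEq] at hxy
    have hxy1 : x = y := by
      have := hxy.1
      rw [he hx.1, he hy.1] at this
      exact e.injOn hx.1 hy.1 this
    subst hxy1
    exact Prod.ext rfl ((hmono x (hDN hx)).injOn hs ht hxy.2)
  · rintro ⟨x, t⟩ ⟨hx, ht⟩ S hS
    rw [mem_map] at hS
    have hcont : ∀ s ∈ Ioo a b, ContinuousAt (fun y => κ (y, s)) x := fun s hs =>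
      (hκ.continuousAt (x := (x, s)) (prod_mem_nhds (mem_of_superset (hDo.mem_nhds hx) hDN)
        (isOpen_Ioo.mem_nhds hs))).slice_fst
    obtain ⟨D₁, hD₁, hxD₁, ε, hε, hbox⟩ := exists_box_subset
      (inter_mem hS (prod_mem_nhds (hDo.mem_nhds hx) (isOpen_Ioo.mem_nhds ht)))
    have hb1 : ∀ s ∈ Icc (t - ε / 2) (t + ε / 2), s ∈ Ioo (t - ε) (t + ε) := fun s hs =>
      ⟨by linarith [hs.1], by linarith [hs.2]⟩
    have hb2 : ∀ s ∈ Icc (t - ε / 2) (t + ε / 2), s ∈ Ioo a b := fun s hs =>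
      (@hbox (x, s) ⟨hxD₁, hb1 s hs⟩).2.2
    have hm1 : t - ε / 2 ∈ Icc (t - ε / 2) (t + ε / 2) := ⟨le_rfl, by linarith⟩
    have hm2 : t + ε / 2 ∈ Icc (t - ε / 2) (t + ε / 2) := ⟨by linarith, le_rfl⟩
    obtain ⟨m₁, hm₁, hm₁'⟩ := exists_between
      (hmono x (hDN hx) (hb2 _ hm1) ht (by linarith : t - ε / 2 < t))
    obtain ⟨m₂, hm₂, hm₂'⟩ := exists_between
      (hmono x (hDN hx) ht (hb2 _ hm2) (by linarith : t < t + ε / 2))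
    have hnear : {y | y ∈ D₁ ∧ κ (y, t - ε / 2) < m₁ ∧ m₂ < κ (y, t + ε / 2)} ∈ 𝓝 x := by
      filter_upwards [hD₁.mem_nhds hxD₁,
        (hcont _ (hb2 _ hm1)).eventually_lt continuousAt_const hm₁,
        continuousAt_const.eventually_lt (hcont _ (hb2 _ hm2)) hm₂'] with y h1 h2 h3
        using ⟨h1, h2, h3⟩
    have himg := image_mem_map (m := h) hnear
    rw [(hcD x hx).map_nhds] at himg
    filter_upwards [prod_mem_nhds himg (Ioo_mem_nhds hm₁' hm₂)]
    rintro ⟨c, u⟩ ⟨⟨y, ⟨hy1, hy2, hy3⟩, rfl⟩, hu⟩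
    have hyD : y ∈ D := (@hbox (y, t) ⟨hy1, by constructor <;> linarith⟩).2.1
    obtain ⟨s, hs, hsu⟩ := intermediate_value_Icc (f := fun s => κ (y, s))
      (by linarith : t - ε / 2 ≤ t + ε / 2)
      (hκ.comp (Continuous.continuousOn (by fun_prop)) fun s hs => ⟨hDN hyD, hb2 s hs⟩)
      ⟨(hy2.trans hu.1).le, (hu.2.trans hy3).le⟩
    have := (@hbox (y, s) ⟨hy1, hb1 s hs⟩).1
    simp only at hsu
    simpa [hsu] using this

/-- The transverse coordinate of `Θ.symm` is constant along a vertical interval, so replacing the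
height of `Θ (x, t)` by that of `Θ (d, t)` does not change it. -/
theorem OpenPartialHomeomorph.eventually_fst_leftInverse [TotallyDisconnectedSpace C]
    (Θ : OpenPartialHomeomorph (C × ℝ) (C' × ℝ)) {d : C} {t : ℝ} (hd : (d, t) ∈ Θ.source) :
    ∀ᶠ x in 𝓝 d, (Θ.symm ((Θ (x, t)).1, (Θ (d, t)).2)).1 = x := by
  obtain ⟨B, hBo, hcB, ε, hε, hB⟩ := exists_box_subset
    (d := (Θ (d, t)).1) (t := (Θ (d, t)).2) (Θ.open_target.mem_nhds (Θ.map_source hd))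
  have hcont : ContinuousAt (fun x => Θ (x, t)) d :=
    (Θ.continuousAt hd).slice_fst
  have h1 : ∀ᶠ x in 𝓝 d, (x, t) ∈ Θ.source :=
    (continuousAt_id.prodMk continuousAt_const).eventually (Θ.open_source.mem_nhds hd)
  filter_upwards [h1, hcont.eventually ((hBo.prod isOpen_Ioo).mem_nhds
    ⟨hcB, sub_lt_self _ hε, lt_add_of_pos_right _ hε⟩)] with x hx hxB'
  have : (Θ.symm ((Θ (x, t)).1, (Θ (d, t)).2)).1 = (Θ.symm ((Θ (x, t)).1, (Θ (x, t)).2)).1 := by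
    refine eqOn_of_isPreconnected (g := fun u => (Θ.symm ((Θ (x, t)).1, u)).1)
      (isPreconnected_Ioo (a := (Θ (d, t)).2 - ε) (b := (Θ (d, t)).2 + ε)) ?_
      ⟨by linarith, by linarith⟩ hxB'.2
    refine continuous_fst.comp_continuousOn (Θ.symm.continuousOn.comp
      (Continuous.continuousOn (by fun_prop)) fun u hu => hB ⟨hxB'.1, hu⟩)
  rw [this, Prod.mk.eta, Θ.left_inv hx]

theorem OpenPartialHomeomorph.eventually_continuousAt_fst
    (Θ : OpenPartialHomeomorph (C × ℝ) (C' × ℝ)) {d : C} {t : ℝ} (hd : (d, t) ∈ Θ.source) :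
    ∀ᶠ x in 𝓝 d, ContinuousAt (fun x => (Θ (x, t)).1) x := by
  have h1 : ∀ᶠ x in 𝓝 d, (x, t) ∈ Θ.source :=
    (continuousAt_id.prodMk continuousAt_const).eventually (Θ.open_source.mem_nhds hd)
  filter_upwards [h1] with x hx using (Θ.continuousAt hx).slice_fst.fst

/-- This is holonomy: the transverse parts of `Θ` and `Θ.symm`, each taken at a fixed height, are
inverse to each other near the point. -/
theorem OpenPartialHomeomorph.locHomeoAt_fst [TotallyDisconnectedSpace C]
    [TotallyDisconnectedSpace C'] (Θ : OpenPartialHomeomorph (C × ℝ) (C' × ℝ)) {d : C} {t : ℝ}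
    (hd : (d, t) ∈ Θ.source) : LocHomeoAt (fun x => (Θ (x, t)).1) d := by
  have hd' : ((Θ (d, t)).1, (Θ (d, t)).2) ∈ Θ.symm.source := Θ.map_source hd
  refine locHomeoAt_of_local_inverse (g := fun c => (Θ.symm (c, (Θ (d, t)).2)).1)
    (Θ.eventually_fst_leftInverse hd) ?_ (Θ.eventually_continuousAt_fst hd)
    (Θ.symm.eventually_continuousAt_fst hd')
  have := Θ.symm.eventually_fst_leftInverse hd'
  simpa [Θ.left_inv hd] using this

end ProductStructure

/-! ### Tubes and their extension through one box. -/

section Tubes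

variable {C X : Type*} [TopologicalSpace C] [TopologicalSpace X]

/-- `φ` is a local homeomorphism along `{d} × [v, w]`; the path `t ↦ φ (d, t)` then runs in a
leaf, and `φ` describes the neighboring leaves. -/
def IsTube (φ : C × ℝ → X) (d : C) (v w : ℝ) : Prop :=
  ∀ t ∈ Icc v w, LocHomeoAt φ (d, t)

theorem ContinuousAt.slice_snd {Y : Type*} [TopologicalSpace Y] {f : C × ℝ → Y} {x : C} {s : ℝ}
    (hf : ContinuousAt f (x, s)) : ContinuousAt (fun t => f (x, t)) s :=
  ContinuousAt.comp (f := fun t => (x, t)) hf (by fun_prop)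

/-- Seen in the box, each strand near `d` rises in a single plaque as it passes `w`; beyond `w` it
is continued in that plaque at unit speed. The hypothesis `hmono` says that the tube enters upwards,
so that the continuation does not fold back. -/
theorem IsTube.glue [TotallyDisconnectedSpace C] {E : OpenPartialHomeomorph X (C × ℝ)}
    {B : Set C} {p q : ℝ} (hE : E.target = B ×ˢ Ioo p q) {φ : C × ℝ → X} {d : C} {v w : ℝ}
    (h : IsTube φ d v w) (hvw : v ≤ w) {c : C} {u u' : ℝ} (hc : c ∈ B) (hu : p < u)
    (huu' : u ≤ u') (hu' : u' < q) (hw : φ (d, w) = E.symm (c, u)) {ε : ℝ} (hε : 0 < ε)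
    (hmono : StrictMonoOn (fun t => (E (φ (d, t))).2) (Ioo (w - ε) (w + ε))) :
    ∃ φ' : C × ℝ → X, IsTube φ' d v (w + (u' - u)) ∧ (∀ t ≤ w, φ' (d, t) = φ (d, t)) ∧
      ∀ t ∈ Icc w (w + (u' - u)), φ' (d, t) = E.symm (c, u + (t - w)) := by
  obtain ⟨e, hde, he⟩ := h w ⟨hvw, le_rfl⟩
  have hcu : (c, u) ∈ E.target := by rw [hE]; exact ⟨hc, hu, huu'.trans_lt hu'⟩
  set Θ := e.trans E with hΘ
  have hdΘ : (d, w) ∈ Θ.source := by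
    rw [hΘ, OpenPartialHomeomorph.trans_source]
    refine ⟨hde, ?_⟩
    rw [mem_preimage, ← he hde, hw]
    exact E.map_target hcu
  have hΘφ : ∀ x ∈ Θ.source, Θ x = E (φ x) ∧ φ x ∈ E.source := by
    intro x hx
    rw [hΘ, OpenPartialHomeomorph.trans_source] at hx
    rw [hΘ, he hx.1]
    exact ⟨rfl, hx.2⟩
  have hΘd : Θ (d, w) = (c, u) := by rw [(hΘφ _ hdΘ).1, hw, E.right_inv hcu]
  have hhom := Θ.locHomeoAt_fst hdΘ
  obtain ⟨D, hDo, hdD, δ, hδ, hD⟩ := exists_box_subset (Θ.open_source.mem_nhds hdΘ)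
  obtain ⟨η, hη, hηδ, hηε⟩ : ∃ η > 0, η < δ ∧ η < ε :=
    ⟨min δ ε / 2, by positivity, by have := min_le_left δ ε; linarith [lt_min hδ hε],
      by have := min_le_right δ ε; linarith [lt_min hδ hε]⟩
  have hsrc : ∀ x ∈ D, ∀ t ∈ Icc (w - η) (w + η), (x, t) ∈ Θ.source := fun x hx t ht =>
    hD ⟨hx, by linarith [ht.1], by linarith [ht.2]⟩
  have hm1 : w - η ∈ Icc (w - η) (w + η) := ⟨le_rfl, by linarith⟩
  have hm2 : w + η ∈ Icc (w - η) (w + η) := ⟨by linarith, le_rfl⟩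
  have hm0 : w ∈ Icc (w - η) (w + η) := ⟨by linarith, by linarith⟩
  have hfst : ∀ x ∈ D, ∀ t ∈ Icc (w - η) (w + η), (Θ (x, t)).1 = (Θ (x, w)).1 := by
    intro x hx t ht
    refine eqOn_of_isPreconnected (g := fun s => (Θ (x, s)).1)
      (isPreconnected_Icc (a := w - η) (b := w + η)) ?_ ht hm0
    exact fun s hs => (Θ.continuousAt (hsrc x hx s hs)).slice_snd.fst.continuousWithinAt
  have hcont : ∀ x ∈ D, ∀ t ∈ Icc (w - η) (w + η), ContinuousAt (fun p => (Θ p).2) (x, t) :=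
    fun x hx t ht => (Θ.continuousAt (hsrc x hx t ht)).snd
  have hd12 : (Θ (d, w - η)).2 < (Θ (d, w + η)).2 := by
    rw [(hΘφ _ (hsrc d hdD _ hm1)).1, (hΘφ _ (hsrc d hdD _ hm2)).1]
    exact hmono ⟨by linarith, by linarith⟩ ⟨by linarith, by linarith⟩ (by linarith)
  set N := {x | x ∈ D ∧ (Θ (x, w - η)).2 < (Θ (x, w + η)).2} with hNdef
  have hN : N ∈ 𝓝 d := by
    filter_upwards [hDo.mem_nhds hdD,
      (hcont d hdD _ hm1).slice_fst.eventually_lt (hcont d hdD _ hm2).slice_fst hd12] with x h1 h2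
    exact ⟨h1, h2⟩
  have hκmono : ∀ x ∈ N, StrictMonoOn (fun t => (Θ (x, t)).2) (Icc (w - η) (w + η)) := by
    rintro x ⟨hx, hlt⟩
    refine ContinuousOn.strictMonoOn_of_injOn_Icc (by linarith) hlt.le
      (fun t ht => (hcont x hx t ht).slice_snd.continuousWithinAt) ?_
    intro s hs t ht hst
    have := Θ.injOn (hsrc x hx s hs) (hsrc x hx t ht)
      (Prod.ext ((hfst x hx s hs).trans (hfst x hx t ht).symm) hst)
    exact congrArg Prod.snd this
  -- The height in the box: the true one up to `w`, then increasing at unit speed.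
  set κ : C × ℝ → ℝ := fun x => (Θ (x.1, min x.2 w)).2 + max (x.2 - w) 0 with hκ
  have hmin : ∀ t, w - η < t → min t w ∈ Icc (w - η) (w + η) := fun t ht =>
    ⟨le_min ht.le (by linarith), (min_le_right _ _).trans (by linarith)⟩
  -- The summand `1` is slack that makes `w + (u' - u)` an interior point.
  have hloc : ∀ t ∈ Ioo (w - η) (w + (u' - u) + 1),
      LocHomeoAt (fun x : C × ℝ => ((Θ (x.1, w)).1, κ x)) (d, t) := by
    intro t ht
    refine hhom.prodMk_strictMonoOn hN ht ?_ ?_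
    · rintro ⟨x, s⟩ ⟨hx, hs⟩
      have h1 : ContinuousAt (fun y : C × ℝ => (Θ (y.1, min y.2 w)).2) (x, s) :=
        ContinuousAt.comp (x := (x, s)) (f := fun y : C × ℝ => (y.1, min y.2 w))
          (g := fun p => (Θ p).2) (hcont x hx.1 _ (hmin s hs.1)) (by fun_prop)
      exact (h1.add (by fun_prop)).continuousWithinAt
    · intro x hx s hs r hr hsr
      simp only [hκ]
      rcases lt_or_ge s w with hsw | hsw
      · have : min s w < min r w := by rw [min_eq_left hsw.le]; exact lt_min hsr hsw
        have := hκmono x hx (hmin s hs.1) (hmin r hr.1) this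
        have h0 : max (s - w) 0 = 0 := max_eq_right (by linarith)
        have h1 := le_max_right (r - w) 0
        simp only at this
        linarith
      · rw [min_eq_right hsw, min_eq_right (hsw.trans hsr.le), max_eq_left (by linarith),
          max_eq_left (by linarith)]
        linarith
  have hκd : ∀ t ∈ Icc w (w + (u' - u)), ((Θ (d, w)).1, κ (d, t)) = (c, u + (t - w)) := by
    intro t ht
    simp only [hκ]
    rw [min_eq_right ht.1, max_eq_left (by linarith [ht.1]), hΘd]
  classical
  set φ' : C × ℝ → X := fun x => if x.2 ≤ w then φ x else E.symm ((Θ (x.1, w)).1, κ x) with hφ'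
  -- The two branches of `φ'` agree on a whole interval before `w`, which makes `φ'` a local
  -- homeomorphism at the seam.
  have hφ'E : ∀ x ∈ N, ∀ t, w - η < t → φ' (x, t) = E.symm ((Θ (x, w)).1, κ (x, t)) := by
    intro x hx t ht
    simp only [hφ']
    split_ifs with htw
    · have h1 : t ∈ Icc (w - η) (w + η) := ⟨ht.le, by linarith⟩
      simp only [hκ]
      rw [min_eq_left htw, max_eq_right (by linarith), add_zero, ← hfst x hx.1 t h1, Prod.mk.eta,
        (hΘφ _ (hsrc x hx.1 t h1)).1, E.left_inv (hΘφ _ (hsrc x hx.1 t h1)).2]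
    · rfl
  refine ⟨φ', ?_, ?_, ?_⟩
  · intro t ht
    rcases lt_or_ge t w with htw | htw
    · refine (h t ⟨ht.1, htw.le⟩).congr ?_
      filter_upwards [(continuous_snd.tendsto (d, t)).eventually (Iio_mem_nhds htw)] with x hx
      simp only [hφ', if_pos (le_of_lt hx)]
    · have ht' : t ∈ Icc w (w + (u' - u)) := ⟨htw, ht.2⟩
      have hEs : LocHomeoAt E.symm (((Θ (d, w)).1, κ (d, t)) : C × ℝ) := by
        refine E.symm.locHomeoAt ?_
        rw [hκd t ht', E.symm_source, hE]
        exact ⟨hc, by linarith [ht'.1], by linarith [ht'.2]⟩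
      refine (hEs.comp (f := fun x : C × ℝ => ((Θ (x.1, w)).1, κ x))
        (hloc t ⟨by linarith, by linarith [ht.2]⟩)).congr ?_
      filter_upwards [prod_mem_nhds hN (Ioi_mem_nhds (by linarith : w - η < t))] with x hx
      exact hφ'E x.1 hx.1 x.2 hx.2
  · intro t ht
    simp only [hφ', if_pos ht]
  · intro t ht
    rw [hφ'E d (mem_of_mem_nhds hN) t (by linarith [ht.1]), hκd t ht]

/-- On a stretch of a tube that stays in one plaque of a box, the height in the box is strictly
monotone. -/
theorem IsTube.exists_strictMonoOn_or_strictAntiOn [TotallyDisconnectedSpace C]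
    {E : OpenPartialHomeomorph X (C × ℝ)} {φ : C × ℝ → X} {d : C} {s x : ℝ}
    (h : IsTube φ d s x) (hsx : s ≤ x) (hsrc : ∀ t ∈ Icc s x, φ (d, t) ∈ E.source) {c : C}
    (hc : (E (φ (d, s))).1 = c) :
    ∃ ε > 0, (∀ t ∈ Icc (s - ε) (x + ε), φ (d, t) ∈ E.source ∧ (E (φ (d, t))).1 = c) ∧
      ContinuousOn (fun t => (E (φ (d, t))).2) (Icc (s - ε) (x + ε)) ∧
      (StrictMonoOn (fun t => (E (φ (d, t))).2) (Icc (s - ε) (x + ε)) ∨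
        StrictAntiOn (fun t => (E (φ (d, t))).2) (Icc (s - ε) (x + ε))) := by
  have hev : ∀ t ∈ Icc s x, ∀ᶠ r in 𝓝 t, LocHomeoAt φ (d, r) ∧ φ (d, r) ∈ E.source := by
    intro t ht
    have h1 : ∀ᶠ r in 𝓝 t, LocHomeoAt φ (d, r) :=
      (Continuous.prodMk_right d).continuousAt.eventually (h t ht).eventually
    exact h1.and ((h t ht).continuousAt.slice_snd.eventually
      (E.open_source.mem_nhds (hsrc t ht)))
  -- Compactness widens `[s, x]` on both sides, so that monotonicity holds across the endpoints.
  obtain ⟨δ, hδ, hthick⟩ := (isCompact_Icc (a := s) (b := x)).exists_cthickening_subset_open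
    (t := interior {r | LocHomeoAt φ (d, r) ∧ φ (d, r) ∈ E.source}) isOpen_interior
    (fun t ht => mem_interior_iff_mem_nhds.2 (hev t ht))
  have hsub : ∀ t ∈ Icc (s - δ) (x + δ), LocHomeoAt φ (d, t) ∧ φ (d, t) ∈ E.source := by
    intro t ht
    suffices t ∈ Metric.cthickening δ (Icc s x) by
      have := interior_subset (hthick this)
      exact this
    rcases lt_or_ge t s with h1 | h1
    · refine Metric.mem_cthickening_of_dist_le t s _ _ ⟨le_rfl, hsx⟩ ?_
      rw [Real.dist_eq, abs_le]; constructor <;> linarith [ht.1]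
    · rcases lt_or_ge x t with h2 | h2
      · refine Metric.mem_cthickening_of_dist_le t x _ _ ⟨hsx, le_rfl⟩ ?_
        rw [Real.dist_eq, abs_le]; constructor <;> linarith [ht.2]
      · refine Metric.mem_cthickening_of_dist_le t t _ _ ⟨h1, h2⟩ ?_
        simpa using hδ.le
  have hcont : ∀ t ∈ Icc (s - δ) (x + δ), ContinuousAt (fun t => E (φ (d, t))) t := fun t ht =>
    (E.continuousAt (hsub t ht).2).comp (f := fun t => φ (d, t))
      (hsub t ht).1.continuousAt.slice_snd
  have hfst : ∀ t ∈ Icc (s - δ) (x + δ), (E (φ (d, t))).1 = c := fun t ht => by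
    rw [← hc]
    exact eqOn_of_isPreconnected (g := fun t => (E (φ (d, t))).1)
      (isPreconnected_Icc (a := s - δ) (b := x + δ))
      (fun t ht => (hcont t ht).fst.continuousWithinAt) ht ⟨by linarith, by linarith⟩
  have hc2 : ContinuousOn (fun t => (E (φ (d, t))).2) (Icc (s - δ) (x + δ)) :=
    fun t ht => (hcont t ht).snd.continuousWithinAt
  refine ⟨δ, hδ, fun t ht => ⟨(hsub t ht).2, hfst t ht⟩, hc2,
    strictMonoOn_or_strictAntiOn_of_locally_injOn (by linarith) hc2 ?_⟩
  intro t ht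
  obtain ⟨e, hte, he⟩ := (hsub t (Ioo_subset_Icc_self ht)).1
  refine ⟨Icc (s - δ) (x + δ) ∩ {r | (d, r) ∈ e.source}, inter_mem (Icc_mem_nhds ht.1 ht.2)
    ((Continuous.prodMk_right d).continuousAt.eventually (e.open_source.mem_nhds hte)), ?_⟩
  intro a ha b hb hab
  have h1 := E.injOn (hsub a ha.1).2 (hsub b hb.1).2
    (Prod.ext ((hfst a ha.1).trans (hfst b hb.1).symm) hab)
  rw [he ha.2, he hb.2] at h1
  exact congrArg Prod.snd (e.injOn ha.2 hb.2 h1)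

end Tubes

/-! ### Prolonging tubes along paths. -/

section Lifts

variable {C X : Type*} [TopologicalSpace C] [TopologicalSpace X]

/-- Either the given tube already reaches height `u'` before `w`, or it climbs in the plaque all the
way to `w` and is then extended there by `IsTube.glue`. -/
theorem IsTube.lift_forward [TotallyDisconnectedSpace C] [T2Space X]
    {E : OpenPartialHomeomorph X (C × ℝ)} {B : Set C} {p q : ℝ} (hE : E.target = B ×ˢ Ioo p q)
    {φ : C × ℝ → X} {d : C} {v w s : ℝ} (h : IsTube φ d v w) (hs : s ∈ Icc v w) {c : C}
    {u u' : ℝ} (hc : c ∈ B) (hu : p < u) (huu' : u ≤ u') (hu' : u' < q)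
    (hsu : φ (d, s) = E.symm (c, u)) {ε : ℝ} (hε : 0 < ε)
    (hmono : StrictMonoOn (fun t => (E (φ (d, t))).2) (Icc (s - ε) (s + ε))) :
    ∃ (φ' : C × ℝ → X) (w' : ℝ), w ≤ w' ∧ IsTube φ' d v w' ∧
      (∀ t ≤ w, φ' (d, t) = φ (d, t)) ∧ ∃ s' ∈ Icc s w', φ' (d, s') = E.symm (c, u') ∧
        ∀ t ∈ Icc s s', φ' (d, t) ∈ E.symm '' ({c} ×ˢ Icc u u') := by
  set P := E.symm '' ({c} ×ˢ Icc u u') with hP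
  have htar : ∀ r ∈ Icc u u', (c, r) ∈ E.target := fun r hr => by
    rw [hE]; exact ⟨hc, hu.trans_le hr.1, hr.2.trans_lt hu'⟩
  have hPc : IsClosed P := by
    refine (IsCompact.image_of_continuousOn (isCompact_singleton.prod isCompact_Icc)
      (E.continuousOn_symm.mono ?_)).isClosed
    rintro ⟨a, r⟩ ⟨ha, hr⟩
    obtain rfl : a = c := ha
    exact htar r hr
  have hPs : ∀ x ∈ P, x ∈ E.source := by
    rintro _ ⟨⟨a, r⟩, ⟨ha, hr⟩, rfl⟩
    obtain rfl : a = c := ha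
    exact E.map_target (htar r hr)
  have hPk : ∀ x ∈ P, (E x).2 ∈ Icc u u' ∧ x = E.symm (c, (E x).2) := by
    rintro _ ⟨⟨a, r⟩, ⟨ha, hr⟩, rfl⟩
    obtain rfl : a = c := ha
    rw [E.right_inv (htar r hr)]
    exact ⟨hr, rfl⟩
  have hEs : E (φ (d, s)) = (c, u) := by rw [hsu, E.right_inv (htar u ⟨le_rfl, huu'⟩)]
  have hsP : φ (d, s) ∈ P := ⟨(c, u), ⟨rfl, le_rfl, huu'⟩, hsu.symm⟩
  have hcont : ∀ t ∈ Icc v w, ContinuousAt (fun t => φ (d, t)) t := fun t ht =>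
    (h t ht).continuousAt.slice_snd
  have hup : ∀ x ∈ Icc s w, (∀ t ∈ Icc s x, φ (d, t) ∈ P) → ∃ δ > 0,
      (∀ t ∈ Icc (s - δ) (x + δ), φ (d, t) ∈ E.source ∧ (E (φ (d, t))).1 = c) ∧
      ContinuousOn (fun t => (E (φ (d, t))).2) (Icc (s - δ) (x + δ)) ∧
      StrictMonoOn (fun t => (E (φ (d, t))).2) (Icc (s - δ) (x + δ)) := by
    intro x hx hxP
    have hsx : IsTube φ d s x := fun t ht => h t ⟨hs.1.trans ht.1, ht.2.trans hx.2⟩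
    obtain ⟨δ, hδ, h1, h2, h3⟩ := hsx.exists_strictMonoOn_or_strictAntiOn hx.1
      (fun t ht => hPs _ (hxP t ht)) (by rw [hEs])
    -- Monotonicity on the long interval has the direction prescribed near `s` by `hmono`.
    refine ⟨δ, hδ, h1, h2, h3.resolve_right fun hanti => ?_⟩
    have hm : 0 < min δ ε := lt_min hδ hε
    have hm1 := min_le_left δ ε
    have hm2 := min_le_right δ ε
    have h4 := hmono (a := s) ⟨by linarith, by linarith⟩ (b := s + min δ ε)
      ⟨by linarith, by linarith⟩ (by linarith)
    have h5 := hanti (a := s) ⟨by linarith, by linarith [hx.1]⟩ (b := s + min δ ε)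
      ⟨by linarith, by linarith [hx.1]⟩ (by linarith)
    exact lt_asymm h4 h5
  by_cases hreach : ∃ x ∈ Icc s w, φ (d, x) = E.symm (c, u') ∧ ∀ t ∈ Icc s x, φ (d, t) ∈ P
  · obtain ⟨x, hx, h1, h2⟩ := hreach
    exact ⟨φ, w, le_rfl, h, fun _ _ => rfl, x, hx, h1, h2⟩
  have hlt : ∀ x ∈ Icc s w, (∀ t ∈ Icc s x, φ (d, t) ∈ P) → (E (φ (d, x))).2 < u' := by
    intro x hx hxP
    obtain ⟨h1, h2⟩ := hPk _ (hxP x ⟨hx.1, le_rfl⟩)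
    refine lt_of_le_of_ne h1.2 fun h3 => hreach ⟨x, hx, ?_, hxP⟩
    rw [h2, h3]
  set S := {x | ∀ t ∈ Icc s x, φ (d, t) ∈ P} with hS
  -- Continuous induction along `[s, w]`: the plaque segment is closed, and a strand still below
  -- `u'` can climb a little further inside it.
  have hwS : w ∈ S := by
    have hT : IsClosed (Icc s w ∩ (fun t => φ (d, t)) ⁻¹' P) :=
      ContinuousOn.preimage_isClosed_of_isClosed
        (fun t ht => (hcont t ⟨hs.1.trans ht.1, ht.2⟩).continuousWithinAt) isClosed_Icc hPc
    refine IsClosed.mem_of_ge_of_forall_exists_gt (a := s) (b := w) (s := S) ?_ ?_ hs.2 ?_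
    · refine isClosed_of_closure_subset fun x hx => ?_
      have hxT : x ∈ Icc s w ∩ (fun t => φ (d, t)) ⁻¹' P :=
        closure_minimal (fun y (hy : y ∈ S ∩ Icc s w) =>
          (⟨hy.2, hy.1 y ⟨hy.2.1, le_rfl⟩⟩ : y ∈ Icc s w ∩ (fun t => φ (d, t)) ⁻¹' P)) hT hx
      refine ⟨fun t ht => ?_, hxT.1⟩
      rcases ht.2.lt_or_eq with htx | rfl
      · obtain ⟨y, hy1, hy2⟩ := mem_closure_iff.1 hx _ isOpen_Ioi htx
        exact hy2.1 t ⟨ht.1, le_of_lt hy1⟩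
      · exact hxT.2
    · intro t ht
      rw [le_antisymm ht.2 ht.1]; exact hsP
    · rintro x ⟨hxS, hx⟩
      have hx' : x ∈ Icc s w := ⟨hx.1, hx.2.le⟩
      obtain ⟨δ, hδ, h1, h2, h3⟩ := hup x hx' hxS
      have hxm : x ∈ Icc (s - δ) (x + δ) := ⟨by linarith [hx.1], by linarith⟩
      have hxc := h2.continuousAt (Icc_mem_nhds (by linarith [hx.1] : s - δ < x)
        (by linarith : x < x + δ))
      have h4 : ∀ᶠ y in 𝓝[>] x, (E (φ (d, y))).2 < u' ∧ y < min w (x + δ) :=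
        ((hxc.eventually_lt continuousAt_const (hlt x hx' hxS)).and
          (Iio_mem_nhds (lt_min hx.2 (by linarith)))).filter_mono nhdsWithin_le_nhds
      obtain ⟨y, ⟨hy1, hy2⟩, hy3⟩ := (h4.and self_mem_nhdsWithin).exists
      have hy3 : x < y := hy3
      have hyw := hy2.trans_le (min_le_left _ _)
      have hyδ := hy2.trans_le (min_le_right _ _)
      refine ⟨y, fun t ht => ?_, hy3, hyw.le⟩
      have htm : t ∈ Icc (s - δ) (x + δ) := ⟨by linarith [ht.1], by linarith [ht.2]⟩
      have hsm : s ∈ Icc (s - δ) (x + δ) := ⟨by linarith, by linarith [hx.1]⟩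
      have hym : y ∈ Icc (s - δ) (x + δ) := ⟨by linarith [hx.1], by linarith⟩
      refine ⟨E (φ (d, t)), ⟨(h1 t htm).2, ?_, ?_⟩, E.left_inv (h1 t htm).1⟩
      · have := h3.monotoneOn hsm htm ht.1
        simpa only [hEs] using this
      · exact (h3.monotoneOn htm hym ht.2).trans hy1.le
  have hww : w ∈ Icc s w := ⟨hs.2, le_rfl⟩
  obtain ⟨δ, hδ, h1, h2, h3⟩ := hup w hww hwS
  obtain ⟨h4, h5⟩ := hPk _ (hwS w hww)
  obtain ⟨φ', hφ'1, hφ'2, hφ'3⟩ := h.glue hE (hs.1.trans hs.2) hc (hu.trans_le h4.1) h4.2 hu'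
    h5 hδ (h3.mono fun t ht => ⟨by linarith [ht.1, hs.2], ht.2.le⟩)
  have h6 := h4.2
  refine ⟨φ', _, by linarith, hφ'1, hφ'2, _, ⟨by linarith [hs.2], le_rfl⟩, ?_, ?_⟩
  · rw [hφ'3 _ ⟨by linarith, le_rfl⟩]
    congr 2; ring
  · intro t ht
    rcases le_or_gt t w with htw | htw
    · rw [hφ'2 t htw]; exact hwS t ⟨ht.1, htw⟩
    · rw [hφ'3 t ⟨htw.le, ht.2⟩]
      exact ⟨(c, _), ⟨rfl, by linarith [h4.1], by linarith [ht.2]⟩, rfl⟩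

/-- Every tube one of whose points is `x` can be prolonged along `S` so as to reach `y`. -/
def LiftsTo (C : Type*) [TopologicalSpace C] (S : Set X) (x y : X) : Prop :=
  ∀ (φ : C × ℝ → X) (d : C) (v w s : ℝ), IsTube φ d v w → s ∈ Icc v w → φ (d, s) = x →
    ∃ (φ' : C × ℝ → X) (v' w' : ℝ), v' ≤ v ∧ w ≤ w' ∧ IsTube φ' d v' w' ∧
      (∀ t ∈ Icc v w, φ' (d, t) = φ (d, t)) ∧
      ∃ s' ∈ Icc v' w', φ' (d, s') = y ∧ ∀ t ∈ uIcc s s', φ' (d, t) ∈ S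

theorem LiftsTo.mono {S T : Set X} {x y : X} (h : LiftsTo C S x y) (hST : S ⊆ T) :
    LiftsTo C T x y := by
  intro φ d v w s hφ hs hx
  obtain ⟨φ', v', w', h1, h2, h3, h4, s', hs', h5, h6⟩ := h φ d v w s hφ hs hx
  exact ⟨φ', v', w', h1, h2, h3, h4, s', hs', h5, fun t ht => hST (h6 t ht)⟩

theorem LiftsTo.trans {S : Set X} {x y z : X} (h : LiftsTo C S x y) (h' : LiftsTo C S y z) :
    LiftsTo C S x z := by
  intro φ d v w s hφ hs hx
  obtain ⟨φ₁, v₁, w₁, hv₁, hw₁, hφ₁, heq₁, s₁, hs₁, hy, hS₁⟩ := h φ d v w s hφ hs hx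
  obtain ⟨φ₂, v₂, w₂, hv₂, hw₂, hφ₂, heq₂, s₂, hs₂, hz, hS₂⟩ := h' φ₁ d v₁ w₁ s₁ hφ₁ hs₁ hy
  refine ⟨φ₂, v₂, w₂, hv₂.trans hv₁, hw₁.trans hw₂, hφ₂, fun t ht => ?_, s₂, hs₂, hz, ?_⟩
  · rw [heq₂ t ⟨hv₁.trans ht.1, ht.2.trans hw₁⟩, heq₁ t ht]
  · intro t ht
    rcases uIcc_subset_uIcc_union_uIcc (b := s₁) ht with ht | ht
    · have : t ∈ Icc v₁ w₁ :=
        (ordConnected_Icc.uIcc_subset ⟨hv₁.trans hs.1, hs.2.trans hw₁⟩ hs₁) ht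
      rw [heq₂ t this]
      exact hS₁ t ht
    · exact hS₂ t ht

theorem IsTube.reverse {φ : C × ℝ → X} {d : C} {v w : ℝ} (h : IsTube φ d v w) :
    IsTube (fun x => φ (x.1, -x.2)) d (-w) (-v) := by
  intro t ht
  have h1 := ((Homeomorph.refl C).prodCongr (Homeomorph.neg ℝ)).toOpenPartialHomeomorph.locHomeoAt
    (y := (d, t)) (mem_univ _)
  exact LocHomeoAt.comp (g := φ) (h (-t) ⟨by linarith [ht.2], by linarith [ht.1]⟩) h1

theorem liftsTo_plaque_of_le [TotallyDisconnectedSpace C] [T2Space X]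
    {E : OpenPartialHomeomorph X (C × ℝ)} {B : Set C} {p q : ℝ} (hE : E.target = B ×ˢ Ioo p q)
    {c : C} {u u' : ℝ} (hc : c ∈ B) (hu : p < u) (huu' : u ≤ u') (hu' : u' < q) :
    LiftsTo C (E.symm '' ({c} ×ˢ Icc u u')) (E.symm (c, u)) (E.symm (c, u')) := by
  intro φ d v w s h hs hsu
  have hcu : (c, u) ∈ E.target := by rw [hE]; exact ⟨hc, hu, huu'.trans_lt hu'⟩
  have hss : IsTube φ d s s := fun t ht => h t ⟨hs.1.trans ht.1, ht.2.trans hs.2⟩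
  obtain ⟨ε, hε, -, -, hm | hm⟩ := hss.exists_strictMonoOn_or_strictAntiOn (E := E) le_rfl
    (fun t ht => by
      rw [le_antisymm ht.2 ht.1, hsu]; exact E.map_target hcu) rfl
  · obtain ⟨φ', w', h1, h2, h3, s', h4, h5, h6⟩ :=
      h.lift_forward hE hs hc hu huu' hu' hsu hε hm
    refine ⟨φ', v, w', le_rfl, h1, h2, fun t ht => h3 t ht.2, s', ⟨hs.1.trans h4.1, h4.2⟩, h5, ?_⟩
    rwa [uIcc_of_le h4.1]
  · obtain ⟨φ', w', h1, h2, h3, s', h4, h5, h6⟩ :=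
      h.reverse.lift_forward hE (s := -s) ⟨by linarith [hs.2], by linarith [hs.1]⟩ hc hu huu' hu'
        (by simpa using hsu) hε (fun a ha b hb hab => hm ⟨by linarith [hb.2], by linarith [hb.1]⟩
          ⟨by linarith [ha.2], by linarith [ha.1]⟩ (by linarith))
    refine ⟨fun x => φ' (x.1, -x.2), -w', w, by linarith, le_rfl, by simpa using h2.reverse,
      fun t ht => ?_, -s', ⟨by linarith [h4.2], by linarith [h4.1, hs.2]⟩, by simpa using h5, ?_⟩
    · have := h3 (-t) (by linarith [ht.1])
      simpa using this
    · intro t ht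
      rw [uIcc_of_ge (by linarith [h4.1])] at ht
      exact h6 (-t) ⟨by linarith [ht.2], by linarith [ht.1]⟩

theorem liftsTo_plaque [TotallyDisconnectedSpace C] [T2Space X]
    {E : OpenPartialHomeomorph X (C × ℝ)} {B : Set C} {p q : ℝ} (hE : E.target = B ×ˢ Ioo p q)
    {c : C} {u u' : ℝ} (hc : c ∈ B) (hu : u ∈ Ioo p q) (hu' : u' ∈ Ioo p q) :
    LiftsTo C (E.symm '' ({c} ×ˢ uIcc u u')) (E.symm (c, u)) (E.symm (c, u')) := by
  rcases le_total u u' with huu' | huu'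
  · rw [uIcc_of_le huu']
    exact liftsTo_plaque_of_le hE hc hu.1 huu' hu'.2
  · set E' := E.transHomeomorph ((Homeomorph.refl C).prodCongr (Homeomorph.neg ℝ)) with hE'
    have hE't : E'.target = B ×ˢ Ioo (-q) (-p) := by
      ext ⟨a, r⟩
      have : (a, r) ∈ E'.target ↔ (a, -r) ∈ E.target := Iff.rfl
      rw [this, hE]
      simp only [mem_prod, mem_Ioo]
      constructor
      · rintro ⟨h1, h2, h3⟩; exact ⟨h1, by linarith, by linarith⟩
      · rintro ⟨h1, h2, h3⟩; exact ⟨h1, by linarith, by linarith⟩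
    have hsymm : ∀ a r, E'.symm (a, r) = E.symm (a, -r) := fun a r => rfl
    have := liftsTo_plaque_of_le hE't hc (u := -u) (u' := -u') (by linarith [hu.2])
      (by linarith) (by linarith [hu'.1])
    rw [hsymm, hsymm, neg_neg, neg_neg] at this
    refine this.mono ?_
    rintro _ ⟨⟨a, r⟩, ⟨ha, hr⟩, rfl⟩
    rw [hsymm]
    refine ⟨(a, -r), ⟨ha, ?_⟩, rfl⟩
    rw [uIcc_of_ge huu']
    exact ⟨by linarith [hr.2], by linarith [hr.1]⟩

/-- `X` is covered by charts with values in open boxes of `C × ℝ`. -/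
def HasBoxCharts (C X : Type*) [TopologicalSpace C] [TopologicalSpace X] : Prop :=
  ∀ x : X, ∃ (E : OpenPartialHomeomorph X (C × ℝ)) (B : Set C) (p q : ℝ),
    x ∈ E.source ∧ E.target = B ×ˢ Ioo p q

/-- Locally the path stays in one plaque, and by the intermediate value theorem it covers the plaque
segment between any two of its nearby points. So the local lifts run inside the image of the path,
and connectedness of `[a, b]` chains them. -/
theorem HasBoxCharts.liftsTo_image [TotallyDisconnectedSpace C] [T2Space X]
    (hX : HasBoxCharts C X) {δ : ℝ → X} {a b : ℝ} (hδ : ContinuousOn δ (Icc a b)) {r r' : ℝ}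
    (hr : r ∈ Icc a b) (hr' : r' ∈ Icc a b) : LiftsTo C (δ '' Icc a b) (δ r) (δ r') := by
  refine isPreconnected_Icc.induction₂' (fun r r' => LiftsTo C (δ '' Icc a b) (δ r) (δ r')) ?_
    (fun _ _ _ _ _ _ => LiftsTo.trans) hr hr'
  intro x hx
  obtain ⟨E, B, p, q, hxE, hE⟩ := hX (δ x)
  obtain ⟨ε, hε, hball⟩ := Metric.mem_nhdsWithin_iff.1
    ((hδ x hx).eventually (E.open_source.mem_nhds hxE))
  set I := Metric.ball x ε ∩ Icc a b with hI
  have hIo : OrdConnected I := by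
    rw [hI, Real.ball_eq_Ioo]; exact ordConnected_Ioo.inter ordConnected_Icc
  have hEc : ContinuousOn (fun r => E (δ r)) I :=
    E.continuousOn.comp (hδ.mono inter_subset_right) hball
  have key : ∀ y ∈ I, ∀ z ∈ I, LiftsTo C (δ '' Icc a b) (δ y) (δ z) := by
    intro y hy z hz
    have hfst : ∀ s ∈ I, (E (δ s)).1 = (E (δ y)).1 := fun s hs =>
      eqOn_of_isPreconnected (g := fun r => (E (δ r)).1) hIo.isPreconnected hEc.fst hs hy
    have hty := E.map_source (hball hy)
    have htz := E.map_source (hball hz)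
    rw [hE] at hty htz
    have hyE : E.symm ((E (δ y)).1, (E (δ y)).2) = δ y := E.left_inv (hball hy)
    have hzE : E.symm ((E (δ y)).1, (E (δ z)).2) = δ z := by
      rw [← hfst z hz]; exact E.left_inv (hball hz)
    have h := liftsTo_plaque hE hty.1 hty.2 htz.2
    rw [hyE, hzE] at h
    refine h.mono ?_
    rintro _ ⟨⟨c, u⟩, ⟨hc, hu⟩, rfl⟩
    obtain rfl : c = (E (δ y)).1 := hc
    have hsub := hIo.uIcc_subset hy hz
    obtain ⟨s, hs, rfl⟩ := intermediate_value_uIcc (hEc.snd.mono hsub) hu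
    refine ⟨s, (hsub hs).2, ?_⟩
    simp only
    rw [← hfst s (hsub hs)]
    exact (E.left_inv (hball (hsub hs))).symm
  have hxI : x ∈ I := ⟨Metric.mem_ball_self hε, hx⟩
  filter_upwards [self_mem_nhdsWithin, mem_nhdsWithin_of_mem_nhds (Metric.ball_mem_nhds x hε)]
    with y hy1 hy2
  exact ⟨key x hxI y ⟨hy2, hy1⟩, key y ⟨hy2, hy1⟩ x hxI⟩

end Lifts

/-! ### Disjoint strands and closed connected sets. -/

section Strands

variable {C X : Type*} [TopologicalSpace C] [TopologicalSpace X]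

theorem IsTube.eventually_nhds {φ : C × ℝ → X} {d : C} {v w : ℝ} (h : IsTube φ d v w) :
    ∀ᶠ x in 𝓝 d, IsTube φ x v w :=
  isCompact_Icc.eventually_forall_of_forall_eventually (P := fun x t => LocHomeoAt φ (x, t))
    fun t ht => (h t ht).eventually

theorem IsTube.continuousOn {φ : C × ℝ → X} {d : C} {v w : ℝ} (h : IsTube φ d v w) :
    ContinuousOn (fun t => φ (d, t)) (Icc v w) :=
  fun t ht => (h t ht).continuousAt.slice_snd.continuousWithinAt

theorem IsTube.isClosed_image [T2Space X] {φ : C × ℝ → X} {d : C} {v w : ℝ}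
    (h : IsTube φ d v w) : IsClosed ((fun t => φ (d, t)) '' Icc v w) :=
  (isCompact_Icc.image_of_continuousOn h.continuousOn).isClosed

theorem IsTube.eventually_forall_mem {φ : C × ℝ → X} {d : C} {v w : ℝ} (h : IsTube φ d v w)
    {U : Set X} (hU : IsOpen U) (hφ : ∀ t ∈ Icc v w, φ (d, t) ∈ U) :
    ∀ᶠ x in 𝓝 d, ∀ t ∈ Icc v w, φ (x, t) ∈ U :=
  isCompact_Icc.eventually_forall_of_forall_eventually (P := fun x t => φ (x, t) ∈ U)
    fun t ht => (h t ht).continuousAt.eventually (hU.mem_nhds (hφ t ht))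

/-- Only finitely many strands near a given one can meet it. -/
theorem IsTube.exists_disjoint_strand [TotallyDisconnectedSpace C] [CompactSpace C] [T2Space C]
    [∀ c : C, (𝓝[≠] c).NeBot] [T2Space X] {φ : C × ℝ → X} {d : C} {v w : ℝ}
    (h : IsTube φ d v w) {N : Set C} (hN : N ∈ 𝓝 d) :
    ∃ x ∈ N, ∀ t ∈ Icc v w, φ (x, t) ∈ ((fun t => φ (d, t)) '' Icc v w)ᶜ := by
  obtain ⟨K, hK, hKN, hKc⟩ := local_compact_nhds (inter_mem hN h.eventually_nhds)
  -- The coincidences `φ (x, t) = φ (d, s)` form a compact set on which `x` is locally constant,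
  -- since a piece of the strand of `d` inside a chart lies in one plaque. Hence only finitely many
  -- `x` occur, while neighborhoods in `C` are infinite.
  set G : Set ((C × ℝ) × ℝ) := ((K ×ˢ Icc v w) ×ˢ Icc v w) ∩
    (fun y => (φ y.1, φ (d, y.2))) ⁻¹' diagonal X with hG
  have hGc : IsCompact G := by
    refine ((hKc.prod isCompact_Icc).prod isCompact_Icc).of_isClosed_subset ?_ inter_subset_left
    refine ContinuousOn.preimage_isClosed_of_isClosed ?_
      ((hKc.isClosed.prod isClosed_Icc).prod isClosed_Icc) isClosed_diagonal
    rintro ⟨⟨x, t⟩, s⟩ ⟨⟨hx, ht⟩, hs⟩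
    refine ContinuousAt.continuousWithinAt (ContinuousAt.prodMk ?_ ?_)
    · exact ContinuousAt.comp (f := fun y : (C × ℝ) × ℝ => y.1) ((hKN hx).2 t ht).continuousAt
        continuousAt_fst
    · exact ContinuousAt.comp (f := fun y : (C × ℝ) × ℝ => y.2) (x := ((x, t), s))
        (h s hs).continuousAt.slice_snd continuousAt_snd
  have hfin : ((fun y : (C × ℝ) × ℝ => y.1.1) '' G).Finite := by
    refine hGc.induction_on (p := fun S => ((fun y : (C × ℝ) × ℝ => y.1.1) '' S).Finite)
      (by simp) (fun S T hST hT => hT.subset (image_mono hST))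
      (fun S T hS hT => by rw [image_union]; exact hS.union hT) ?_
    rintro ⟨⟨x, t⟩, s⟩ ⟨⟨⟨hx, ht⟩, hs⟩, heq⟩
    have heq : φ (x, t) = φ (d, s) := heq
    obtain ⟨e, hxe, he⟩ := (hKN hx).2 t ht
    have hse : φ (d, s) ∈ e.target := by rw [← heq, he hxe]; exact e.map_source hxe
    obtain ⟨ε, hε, hball⟩ := Metric.mem_nhdsWithin_iff.1
      ((h.continuousOn s hs).eventually (e.open_target.mem_nhds hse))
    refine ⟨_, inter_mem_nhdsWithin G (prod_mem_nhds (e.open_source.mem_nhds hxe)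
      (Metric.ball_mem_nhds s hε)), (finite_singleton x).subset ?_⟩
    rintro _ ⟨⟨⟨x', t'⟩, s'⟩, ⟨⟨⟨-, hs'⟩, heq'⟩, hxe', hs's⟩, rfl⟩
    have heq' : φ (x', t') = φ (d, s') := heq'
    have hI : IsPreconnected (Metric.ball s ε ∩ Icc v w) := by
      rw [Real.ball_eq_Ioo]; exact (ordConnected_Ioo.inter ordConnected_Icc).isPreconnected
    have h1 := eqOn_of_isPreconnected (g := fun r => (e.symm (φ (d, r))).1) hI
      (e.continuousOn_symm.comp (h.continuousOn.mono inter_subset_right) hball).fst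
      ⟨hs's, hs'⟩ ⟨Metric.mem_ball_self hε, hs⟩
    simp only at h1
    rw [← heq, ← heq', he hxe, he hxe', e.left_inv hxe, e.left_inv hxe'] at h1
    exact h1
  obtain ⟨x, hxK, hx⟩ := ((infinite_of_mem_nhds d hK).sdiff hfin).nonempty
  refine ⟨x, (hKN hxK).1, ?_⟩
  rintro t ht ⟨s, hs, hst⟩
  exact hx ⟨((x, t), s), ⟨⟨⟨hxK, ht⟩, hs⟩, hst.symm⟩, rfl⟩

/-- A closed connected set cannot have an interior point on a strand that leaves the set on
both sides. -/
theorem IsTube.mem_of_mem_interior [TotallyDisconnectedSpace C] [CompactSpace C] [T2Space C]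
    [∀ c : C, (𝓝[≠] c).NeBot] [T2Space X] {φ : C × ℝ → X} {d : C} {v w m : ℝ}
    (h : IsTube φ d v w) (hm : m ∈ Ioo v w) {A : Set X} (hA : IsClosed A)
    (hAc : IsPreconnected A) (hmA : φ (d, m) ∈ interior A) (hv : φ (d, v) ∉ A) :
    φ (d, w) ∈ A := by
  by_contra hw
  have hvw : v ≤ w := (hm.1.trans hm.2).le
  have hcont : ∀ t ∈ Icc v w, ContinuousAt (fun x => φ (x, t)) d := fun t ht =>
    (h t ht).continuousAt.slice_fst
  obtain ⟨x, hxA, hx⟩ := h.exists_disjoint_strand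
    ((hcont m (Ioo_subset_Icc_self hm)).eventually (isOpen_interior.mem_nhds hmA))
  have hxm := hx m (Ioo_subset_Icc_self hm)
  have hne : ∀ t ∈ Icc v w, φ (d, t) ∈ ({φ (x, m)} : Set X)ᶜ := fun t ht h' =>
    hxm ⟨t, ht, h'⟩
  -- Strands over the clopen set `K` have both ends outside `A` and avoid `φ (x, m)`, which will be
  -- a point of `A` off the tube.
  obtain ⟨K, ⟨hdK, hKo⟩, hK⟩ := (nhds_basis_clopen d).mem_iff.1 <|
    h.eventually_nhds.and <| (h.eventually_forall_mem isOpen_compl_singleton hne).and <|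
      ((hcont v ⟨le_rfl, hvw⟩).eventually (hA.isOpen_compl.mem_nhds hv)).and
      ((hcont w ⟨hvw, le_rfl⟩).eventually (hA.isOpen_compl.mem_nhds hw))
  set Q := φ '' (K ×ˢ Icc v w) with hQ
  set O := φ '' (K ×ˢ Ioo v w) with hO
  have hOQ : O ⊆ Q := image_mono (prod_mono_right Ioo_subset_Icc_self)
  have hQc : IsClosed Q := by
    refine ((hKo.isClosed.isCompact.prod isCompact_Icc).image_of_continuousOn ?_).isClosed
    exact fun y hy => ((hK hy.1).1 y.2 hy.2).continuousAt.continuousWithinAt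
  have hOo : IsOpen O := isOpen_image_of_locHomeoAt (hKo.isOpen.prod isOpen_Ioo)
    fun y hy => (hK hy.1).1 y.2 (Ioo_subset_Icc_self hy.2)
  -- As the ends lie outside `A`, the open sets `O` and `Qᶜ` cover `A`; both meet `A`, yet they are
  -- disjoint.
  obtain ⟨y, -, hyO, hyQ⟩ := hAc O Qᶜ hOo hQc.isOpen_compl
    (by
      intro a ha
      by_cases haQ : a ∈ Q
      · left
        obtain ⟨⟨y, t⟩, ⟨hy, ht⟩, rfl⟩ := haQ
        obtain ⟨-, -, h3, h4⟩ := hK hy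
        refine ⟨(y, t), ⟨hy, lt_of_le_of_ne ht.1 ?_, lt_of_le_of_ne ht.2 ?_⟩, rfl⟩
        · rintro rfl; exact h3 ha
        · rintro rfl; exact h4 ha
      · exact Or.inr haQ)
    ⟨_, interior_subset hmA, ⟨(d, m), ⟨hdK, hm⟩, rfl⟩⟩
    ⟨_, interior_subset hxA, fun ⟨⟨y, t⟩, ⟨hy, ht⟩, hyt⟩ => (hK hy).2.1 t ht hyt⟩
  exact hyQ (hOQ hyO)

theorem HasBoxCharts.liftsTo_univ [TotallyDisconnectedSpace C] [T2Space X]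
    (hX : HasBoxCharts C X) {x y : X} (hxy : Joined x y) : LiftsTo C univ x y := by
  obtain ⟨γ⟩ := hxy
  have := hX.liftsTo_image (δ := γ.extend) (a := 0) (b := 1) γ.continuous_extend.continuousOn
    (left_mem_Icc.2 zero_le_one) (right_mem_Icc.2 zero_le_one)
  simp only [Path.extend_zero, Path.extend_one] at this
  exact this.mono (subset_univ _)

/-- If the path component of a strand is dense, then the strand cannot lead out of both members
of a cover by two closed connected sets. -/
theorem IsTube.mem_or_mem_of_dense [TotallyDisconnectedSpace C] [CompactSpace C] [T2Space C]
    [∀ c : C, (𝓝[≠] c).NeBot] [T2Space X] (hX : HasBoxCharts C X) {φ : C × ℝ → X} {d : C}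
    {v w : ℝ} (h : IsTube φ d v w) (hvw : v < w) (hd : Dense (pathComponent (φ (d, v))))
    {A B : Set X} (hA : IsClosed A) (hB : IsClosed B) (hAc : IsPreconnected A)
    (hBc : IsPreconnected B) (hAB : A ∪ B = univ) : φ (d, v) ∈ A ∨ φ (d, w) ∈ B := by
  by_contra! hcon
  obtain ⟨hvA, hwB⟩ := hcon
  have hintB : ∀ x, x ∉ A → x ∈ interior B := fun x hx =>
    interior_maximal (fun y hy => (hAB.symm ▸ mem_univ y : y ∈ A ∪ B).resolve_left hy)
      hA.isOpen_compl hx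
  have hintA : ∀ x, x ∉ B → x ∈ interior A := fun x hx =>
    interior_maximal (fun y hy => (hAB.symm ▸ mem_univ y : y ∈ A ∪ B).resolve_right hy)
      hB.isOpen_compl hx
  have hvm : v ∈ Icc v w := ⟨le_rfl, hvw.le⟩
  have hwm : w ∈ Icc v w := ⟨hvw.le, le_rfl⟩
  obtain ⟨D, ⟨hdD, hDo⟩, hD⟩ := (nhds_basis_opens d).mem_iff.1 <|
    h.eventually_nhds.and <|
      ((h v hvm).continuousAt.slice_fst.eventually (hA.isOpen_compl.mem_nhds hvA)).and
      ((h w hwm).continuousAt.slice_fst.eventually (hB.isOpen_compl.mem_nhds hwB))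
  obtain ⟨x, hxD, hx⟩ := h.exists_disjoint_strand (hDo.mem_nhds hdD)
  obtain ⟨D', ⟨hxD', hDo'⟩, hD'⟩ := (nhds_basis_opens x).mem_iff.1
    (inter_mem (hDo.mem_nhds hxD)
      ((hD hxD).1.eventually_forall_mem h.isClosed_image.isOpen_compl hx))
  have hOo : IsOpen (φ '' (D' ×ˢ Ioo v w)) :=
    isOpen_image_of_locHomeoAt (hDo'.prod isOpen_Ioo) fun y hy =>
      (hD (hD' hy.1).1).1 y.2 (Ioo_subset_Icc_self hy.2)
  obtain ⟨m, hm⟩ := nonempty_Ioo.2 hvw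
  obtain ⟨_, ⟨⟨y, t⟩, ⟨hy, ht⟩, rfl⟩, hyt⟩ := hd.inter_open_nonempty _ hOo
    ⟨_, ⟨(x, m), ⟨hxD', hm⟩, rfl⟩⟩
  have ht' := Ioo_subset_Icc_self ht
  obtain ⟨hyD, hyd⟩ := hD' hy
  obtain ⟨hyT, hyA, hyB⟩ := hD hyD
  set δ : ℝ → X := fun r => φ (y, r) with hδ
  -- The tube is prolonged to the point `φ (y, t)` at parameter `s`, then from there to each end of
  -- the parallel strand `δ`, keeping inside `δ`.
  obtain ⟨φ₀, v₀, w₀, hv₀, hw₀, hφ₀, heq₀, s, hs, hst, -⟩ :=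
    hX.liftsTo_univ hyt φ d v w v h hvm rfl
  obtain ⟨φ₁, v₁, w₁, hv₁, hw₁, hφ₁, heq₁, s₁, hs₁, hst₁, hsub₁⟩ :=
    hX.liftsTo_image (δ := δ) hyT.continuousOn ht' hvm φ₀ d v₀ w₀ s hφ₀ hs hst
  obtain ⟨φ₂, v₂, w₂, hv₂, hw₂, hφ₂, heq₂, s₂, hs₂, hst₂, hsub₂⟩ :=
    hX.liftsTo_image (δ := δ) hyT.continuousOn ht' hwm φ₁ d v₁ w₁ s hφ₁
      ⟨hv₁.trans hs.1, hs.2.trans hw₁⟩ ((heq₁ s hs).trans hst)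
  have heq : ∀ r ∈ Icc v w, φ₂ (d, r) = φ (d, r) := fun r hr => by
    have hr₀ : r ∈ Icc v₀ w₀ := ⟨hv₀.trans hr.1, hr.2.trans hw₀⟩
    rw [heq₂ r ⟨hv₁.trans hr₀.1, hr₀.2.trans hw₁⟩, heq₁ r hr₀, heq₀ r hr]
  have hsub₁' : ∀ r ∈ uIcc s s₁, φ₂ (d, r) ∈ δ '' Icc v w := fun r hr => by
    rw [heq₂ r (ordConnected_Icc.uIcc_subset ⟨hv₁.trans hs.1, hs.2.trans hw₁⟩ hs₁ hr)]
    exact hsub₁ r hr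
  have hdisj : ∀ r ∈ Icc v w, φ₂ (d, r) ∉ δ '' Icc v w := by
    rintro r hr ⟨r', hr', hrr'⟩
    rw [heq r hr] at hrr'
    exact hyd r' hr' ⟨r, hr, hrr'.symm⟩
  have hend₁ : φ₂ (d, s₁) ∉ A := by rw [heq₂ s₁ hs₁, hst₁]; exact hyA
  have hend₂ : φ₂ (d, s₂) ∉ B := by rw [hst₂]; exact hyB
  have hn₁ : ∀ r ∈ Icc v w, r ∉ uIcc s s₁ := fun r hr hr' => hdisj r hr (hsub₁' r hr')
  have hn₂ : ∀ r ∈ Icc v w, r ∉ uIcc s s₂ := fun r hr hr' => hdisj r hr (hsub₂ r hr')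
  have hvA' : φ₂ (d, v) ∉ A := by rwa [heq v hvm]
  have hwB' : φ₂ (d, w) ∉ B := by rwa [heq w hwm]
  -- Disjointness puts `s` outside `[v, w]`, and keeps the prolongations along `δ` from crossing
  -- back into `[v, w]`. The side on which `s` lies decides which end of `δ` serves.
  have hs' : s ∉ Icc v w := fun hsm => hn₁ s hsm left_mem_uIcc
  rcases lt_or_ge s v with hsv | hsv
  · have hs₂v : s₂ < v := by
      by_contra! hle
      exact hn₂ v hvm (Icc_subset_uIcc ⟨hsv.le, hle⟩)
    have hT : IsTube φ₂ d s₂ w := fun r hr =>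
      hφ₂ r ⟨hs₂.1.trans hr.1, hr.2.trans (hw₀.trans (hw₁.trans hw₂))⟩
    exact hwB' (hT.mem_of_mem_interior ⟨hs₂v, hvw⟩ hB hBc (hintB _ hvA') hend₂)
  · have hsw : w < s := by
      by_contra! hle
      exact hs' ⟨hsv, hle⟩
    have hs₁w : w < s₁ := by
      by_contra! hle
      exact hn₁ w hwm (Icc_subset_uIcc' ⟨hle, hsw.le⟩)
    have hT : IsTube φ₂ d v s₁ := fun r hr =>
      hφ₂ r ⟨(hv₂.trans (hv₁.trans hv₀)).trans hr.1, hr.2.trans (hs₁.2.trans hw₂)⟩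
    exact hend₁ (hT.mem_of_mem_interior ⟨hvw, hs₁w⟩ hA hAc (hintA _ hwB') hvA')

theorem HasBoxCharts.eq_univ_or_eq_univ_of_dense [TotallyDisconnectedSpace C] [CompactSpace C]
    [T2Space C] [∀ c : C, (𝓝[≠] c).NeBot] [T2Space X] (hX : HasBoxCharts C X) {x : X}
    (hx : Dense (pathComponent x)) {A B : Set X} (hA : IsClosed A) (hB : IsClosed B)
    (hAc : IsPreconnected A) (hBc : IsPreconnected B) (hAB : A ∪ B = univ) :
    A = univ ∨ B = univ := by
  by_contra! hcon
  obtain ⟨y, hyA, hy⟩ := hx.inter_open_nonempty _ hA.isOpen_compl (nonempty_compl.2 hcon.1)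
  obtain ⟨z, hzB, hz⟩ := hx.inter_open_nonempty _ hB.isOpen_compl (nonempty_compl.2 hcon.2)
  obtain ⟨E, -, -, -, hyE, -⟩ := hX y
  -- The prolongation starts from a degenerate tube over a single parameter.
  have hEy : IsTube E.symm (E y).1 (E y).2 (E y).2 := by
    intro t ht
    rw [le_antisymm ht.2 ht.1]
    exact E.symm.locHomeoAt (E.map_source hyE)
  obtain ⟨φ, v, w, hv, hw, hφ, heq, s, hs, hsz, -⟩ :=
    hX.liftsTo_univ (hy.symm.trans hz) E.symm (E y).1 (E y).2 (E y).2 (E y).2 hEy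
      ⟨le_rfl, le_rfl⟩ (E.left_inv hyE)
  have hsy : φ ((E y).1, (E y).2) = y := (heq _ ⟨le_rfl, le_rfl⟩).trans (E.left_inv hyE)
  rcases lt_trichotomy (E y).2 s with hlt | heqs | hlt
  · have hT : IsTube φ (E y).1 (E y).2 s := fun r hr => hφ r ⟨hv.trans hr.1, hr.2.trans hs.2⟩
    have := hT.mem_or_mem_of_dense hX hlt
      (by rwa [hsy, pathComponent_congr hy]) hA hB hAc hBc hAB
    rw [hsy, hsz] at this
    exact this.elim hyA hzB
  · rw [← heqs, hsy] at hsz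
    subst hsz
    exact (hAB.symm ▸ mem_univ y : y ∈ A ∪ B).elim hyA hzB
  · have hT : IsTube φ (E y).1 s (E y).2 := fun r hr => hφ r ⟨hs.1.trans hr.1, hr.2.trans hw⟩
    have := hT.mem_or_mem_of_dense hX hlt
      (by rwa [hsz, pathComponent_congr hz]) hB hA hBc hAc (by rwa [union_comm])
    rw [hsy, hsz] at this
    exact this.elim hzB hyA

end Strands

/-! ### The Cantor set, box charts and leaves. -/

section CantorLeaves

instance : CompactSpace cantorSet := isCompact_iff_compactSpace.1 isCompact_cantorSet

instance : TotallyDisconnectedSpace cantorSet :=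
  cantorSetHomeomorphNatToBool.symm.totallyDisconnectedSpace

instance (c : cantorSet) : (𝓝[≠] c).NeBot := by
  -- Flipping the `n`-th binary digit of `c` gives points different from `c` that converge to `c`.
  set H := cantorSetHomeomorphNatToBool with hH
  set f : ℕ → cantorSet := fun n => H.symm (Function.update (H c) n (!(H c n))) with hf
  have hlim : Tendsto f atTop (𝓝 c) := by
    have h1 : Tendsto (fun n => Function.update (H c) n (!(H c n))) atTop (𝓝 (H c)) := by
      refine tendsto_pi_nhds.2 fun k => tendsto_nhds_of_eventually_eq ?_
      filter_upwards [eventually_gt_atTop k] with n hn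
      exact Function.update_of_ne hn.ne _ _
    have h2 := (H.symm.continuous.tendsto (H c)).comp h1
    rwa [H.symm_apply_apply] at h2
  refine mem_closure_iff_nhdsWithin_neBot.1 (mem_closure_of_tendsto hlim (Eventually.of_forall ?_))
  intro n hn
  have h1 : H (f n) n = H c n := by rw [show f n = c from hn]
  simp [hf] at h1

variable {X : Type*} [TopologicalSpace X]

theorem LocallyCantorTimesInterval.hasBoxCharts (hX : LocallyCantorTimesInterval X) :
    HasBoxCharts cantorSet X := by
  intro x
  obtain ⟨e, he, hx⟩ := hX x
  set U := e ⁻¹' interior (range e) with hU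
  have hUo : IsOpen U := isOpen_interior.preimage he.continuous
  have hxi := mem_interior_iff_mem_nhds.2 hx
  obtain ⟨z, rfl⟩ := mem_of_mem_nhds hx
  have : Nonempty U := ⟨⟨z, hxi⟩⟩
  have hf : IsOpenEmbedding (U.domRestrict e) := by
    refine ⟨he.comp IsEmbedding.subtypeVal, ?_⟩
    rw [range_domRestrict, hU, image_preimage_eq_of_subset interior_subset]
    exact isOpen_interior
  have hi : IsOpenEmbedding (fun y : U => ((y : CantorBox).1, ((y : CantorBox).2 : ℝ))) :=
    (IsOpenEmbedding.id.prodMap isOpen_Ioo.isOpenEmbedding_subtypeVal).comp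
      hUo.isOpenEmbedding_subtypeVal
  set F := (hf.toOpenPartialHomeomorph _).symm.trans (hi.toOpenPartialHomeomorph _) with hF
  have hzF : e z ∈ F.source := by
    rw [hF, OpenPartialHomeomorph.trans_source]
    exact ⟨⟨⟨z, hxi⟩, mem_univ _, rfl⟩, mem_univ _⟩
  clear_value F
  obtain ⟨D, hDo, hzD, ε, hε, hD⟩ := exists_box_subset (d := (F (e z)).1) (t := (F (e z)).2)
    (F.open_target.mem_nhds (F.map_source hzF))
  refine ⟨F.trans (OpenPartialHomeomorph.ofSet
    (D ×ˢ Ioo ((F (e z)).2 - ε) ((F (e z)).2 + ε)) (hDo.prod isOpen_Ioo)),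
    D, (F (e z)).2 - ε, (F (e z)).2 + ε, ?_, ?_⟩
  · rw [OpenPartialHomeomorph.trans_source]
    exact ⟨hzF, hzD, sub_lt_self _ hε, lt_add_of_pos_right _ hε⟩
  · rw [OpenPartialHomeomorph.trans_target]
    ext y
    exact ⟨fun h => h.1, fun h => ⟨h, hD h⟩⟩

theorem IsLocalLeaf.isPathConnected {l : Set X} (hl : IsLocalLeaf l) : IsPathConnected l := by
  obtain ⟨e, c, a, he, rfl⟩ := hl
  have : PathConnectedSpace (Ioo (0 : ℝ) 1) :=
    isPathConnected_iff_pathConnectedSpace.1 ((convex_Ioo 0 1).isPathConnected ⟨1 / 2, by norm_num⟩)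
  exact ((isPathConnected_singleton c).prod isPathConnected_univ).image he.1.continuous

theorem isPathConnected_biUnion_of_isChain {L : List (Set X)} (hne : L ≠ [])
    (hL : ∀ l ∈ L, IsPathConnected l) (hc : L.IsChain fun l m => (l ∩ m).Nonempty) :
    IsPathConnected (⋃ l ∈ L, l) := by
  induction L with
  | nil => exact absurd rfl hne
  | cons a L ih =>
    cases L with
    | nil => simpa using hL a (by simp)
    | cons b L =>
      rw [List.isChain_cons_cons] at hc
      have h1 := ih (by simp) (fun l hl => hL l (List.mem_cons_of_mem _ hl)) hc.2
      have h2 : (⋃ l ∈ a :: b :: L, l) = a ∪ ⋃ l ∈ b :: L, l := by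
        ext x; simp
      rw [h2]
      refine (hL a (by simp)).union h1 (hc.1.mono ?_)
      exact inter_subset_inter_right a (subset_biUnion_of_mem (u := fun l => l)
        (show b ∈ {l | l ∈ b :: L} by simp))

theorem leafAt_subset_pathComponent (x : X) : leafAt x ⊆ pathComponent x := by
  rintro y ⟨S, ⟨⟨L, hne, hL, hc, rfl⟩, hx⟩, hy⟩
  exact ((isPathConnected_biUnion_of_isChain hne (fun l hl => (hL l hl).isPathConnected)
    hc).joinedIn x hx y hy).joined

end CantorLeaves

theorem mainTheorem2 (X : Type*) [TopologicalSpace X] [T2Space X] [CompactSpace X]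
    [ConnectedSpace X] (hX : LocallyCantorTimesInterval X)
    (hdense : ∃ x : X, Dense (leafAt x)) :
    IsIndecomposable X := by
  obtain ⟨x, hx⟩ := hdense
  rintro ⟨A, B, hA, hB, hAu, hBu, hAB⟩
  exact (hX.hasBoxCharts.eq_univ_or_eq_univ_of_dense (hx.mono (leafAt_subset_pathComponent x))
    hA.1.isClosed hB.1.isClosed hA.2.isPreconnected hB.2.isPreconnected hAB).elim hAu hBu
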